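/- Let $X$ be a locally compact (Hausdorff) space with countable base, and let $G\colon X\times X\to(0,\infty]$ be a Borel measurable function such that (1) for every $x\in X$, $\lim_{y\to x}G(x,y)=G(x,x)=\infty$, and $G(x,\cdot)$ is bounded outside every neighborhood of $x$; (2) every point of $X$ has an open neighborhood $U$ for which there is a constant $C>0$ with $\min\{G(x,z),G(y,z)\}\le C\,G(x,y)$ for all $x,y,z\in U$. For a finite positive Radon measure $\mu$ on $X$ let $G\mu(x):=\int G(x,y)\,d\mu(y)$, $x\in X$, and for $A\subset X$ let $c^*(A):=\inf\{\mu(X)\colon \mu \text{ a finite positive Radon measure on } X,\ G\mu\ge 1 \text{ on } A\}$. Let $P\subset X$, and let $P_0$ be a countable subset of $P$ that is dense in $P$. Then the following are equivalent: (i) $P$ is a $G_\delta$-set in $X$ and $c^*(P)=0$. (ii) There is a finite positive Radon measure $\mu$ on $X$ with $\mu(X\setminus P)=0$ such that $\{x\in X\colon G\mu(x)=\infty\}=P$. (iii) There is a finite positive Radon measure $\mu$ on $X$ with $\mu(X\setminus P_0)=0$ such that $\{x\in X\colon G\mu(x)=\infty\}=P$. -/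

import Mathlib

open MeasureTheory Topology Filter Set
open scoped ENNReal NNReal

/-- The restriction of `G` to `U × U` has the triangle property: for some `C > 0`,
`G(x,z) ∧ G(y,z) ≤ C G(x,y)` for all `x, y, z ∈ U`. -/
def TrianglePropertyOn {X : Type*} (G : X → X → ℝ≥0∞) (U : Set X) : Prop :=
  ∃ C : ℝ≥0, 0 < C ∧ ∀ x ∈ U, ∀ y ∈ U, ∀ z ∈ U, min (G x z) (G y z) ≤ (C : ℝ≥0∞) * G x y

/-- Every point has an open neighborhood `U` such that the restriction of `G` to `U × U` has the
triangle property. -/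
def LocalTriangleProperty {X : Type*} [TopologicalSpace X] (G : X → X → ℝ≥0∞) : Prop :=
  ∀ x : X, ∃ U : Set X, IsOpen U ∧ x ∈ U ∧ TrianglePropertyOn G U

/-- The kernels under consideration: Borel measurable functions `G : X × X → (0, ∞]` such that,
for every `x`, `lim_{y → x} G(x,y) = G(x,x) = ∞` and `G(x,·)` is bounded outside every
neighborhood of `x`, and such that `G` has the local triangle property. -/
structure IsPotentialKernel {X : Type*} [TopologicalSpace X] [MeasurableSpace X]
    (G : X → X → ℝ≥0∞) : Prop where
  measurable : Measurable (fun p : X × X => G p.1 p.2)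
  pos : ∀ x y, 0 < G x y
  diag : ∀ x, G x x = ∞
  tendsto : ∀ x, Tendsto (fun y => G x y) (𝓝 x) (𝓝 ∞)
  bounded : ∀ x, ∀ N ∈ 𝓝 x, ∃ M : ℝ≥0, ∀ y ∉ N, G x y ≤ (M : ℝ≥0∞)
  localTriangle : LocalTriangleProperty G

/-- The finite (positive) Borel measures on `X` that are carried by `B`. On a locally compact
Hausdorff space with countable base all of them are Radon measures. -/
def finiteMeasuresOn {X : Type*} [MeasurableSpace X] (B : Set X) : Set (Measure X) :=
  {μ | IsFiniteMeasure μ ∧ μ Bᶜ = 0}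

/-- The potential `Gμ(x) = ∫ G(x,y) dμ(y)`. -/
noncomputable def potential {X : Type*} [MeasurableSpace X] (G : X → X → ℝ≥0∞)
    (μ : Measure X) (x : X) : ℝ≥0∞ :=
  ∫⁻ y, G x y ∂μ

/-- `c*(A) = inf {‖μ‖ : μ a finite measure on X with Gμ ≥ 1 on A}`, where `‖μ‖ = μ(X)`. -/
noncomputable def cStar {X : Type*} [MeasurableSpace X] (G : X → X → ℝ≥0∞) (A : Set X) : ℝ≥0∞ :=
  sInf {m | ∃ μ ∈ finiteMeasuresOn (univ : Set X), (∀ x ∈ A, 1 ≤ potential G μ x) ∧ m = μ univ}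

/-! Locally `1 / G` behaves like a quasi-metric: if `G x y ≥ K`, then `min (G x z) K ≤ C * G y z`.
Hence a truncated potential that is large at `x` stays large near `x` up to the factor `C`, although
`G` need not be lower semicontinuous. So every infinity set is a Gδ, and multiplying the measure by
small constants shows that its capacity vanishes.

Conversely, capacity zero gives a finite `ν` with `Gν = ∞` on `P`. The work is to carry `ν` over to
`P₀` and to make the potential finite off `P`.

Moving mass to `P₀`: a point `y` is sent to a nearly optimal point of `P₀`, which preserves `min (G
x y) (κ y)` up to a constant for `x ∈ P`. The scale `κ` must be so large that this truncation keeps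
arbitrarily much of `Gν` wherever `Gν = ∞` (`exists_truncation_scale`). Superposing the resulting
measures restores the value `∞`.

Finiteness off `P`: given an open `U ⊇ P`, a density makes the potential small off `U` without
destroying its poles on `P`. The mass is then collected at points of `P₀` that are locally finite in
an open set `W`, where truncated potentials are locally at least `1` (`exists_locallyDiscrete_aux`).
The new potential is bounded below on `P`, small off `U` and finite off `P`. Summing over open sets
decreasing to `P` gives `∞` exactly on `P`, first locally; a locally finite cover makes the result
global. -/

/-- On `T` the kernel `G` is quasi-symmetric, and `1 / G` is a quasi-metric, with constant `C`. -/
structure QuasiMetricOn {X : Type*} (G : X → X → ℝ≥0∞) (T : Set X) (C : ℕ) : Prop where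
  one_le : 1 ≤ C
  symm : ∀ x ∈ T, ∀ y ∈ T, G x y ≤ C * G y x
  tri : ∀ x ∈ T, ∀ y ∈ T, ∀ z ∈ T, min (G x y) (G x z) ≤ C * G y z

/-- Since `G y y = ∞`, the triangle property for `y, x, y` is quasi-symmetry. Symmetry then moves
the common point to the first variable, at the price of a second factor `N + 1`. -/
lemma TrianglePropertyOn.exists_quasiMetricOn {X : Type*} {G : X → X → ℝ≥0∞} {T : Set X}
    (h : TrianglePropertyOn G T) (hdiag : ∀ x, G x x = ∞) : ∃ C, QuasiMetricOn G T C := by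
  obtain ⟨c, -, hc⟩ := h
  obtain ⟨N, hN⟩ := exists_nat_ge c
  have hsymm : ∀ x ∈ T, ∀ y ∈ T, G x y ≤ ((N + 1 : ℕ) : ℝ≥0∞) * G y x := by
    intro x hx y hy
    have h1 := hc y hy x hx y hy
    rw [hdiag, min_eq_right le_top] at h1
    refine h1.trans (mul_le_mul_left ?_ _)
    have : (c : ℝ≥0∞) ≤ (N : ℝ≥0) := by exact_mod_cast hN
    refine this.trans ?_
    push_cast
    exact le_self_add
  refine ⟨(N + 1) * (N + 1), Nat.succ_le_of_lt (by positivity), ?_, ?_⟩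
  · intro x hx y hy
    refine (hsymm x hx y hy).trans (mul_le_mul_left ?_ _)
    exact_mod_cast Nat.le_mul_of_pos_left _ (by omega)
  · intro x hx y hy z hz
    have h1 : min (G y x) (G z x) ≤ ((N + 1 : ℕ) : ℝ≥0∞) * G y z := by
      refine (hc y hy z hz x hx).trans (mul_le_mul_left ?_ _)
      have : (c : ℝ≥0∞) ≤ (N : ℝ≥0) := by exact_mod_cast hN
      refine this.trans ?_
      push_cast
      exact le_self_add
    calc min (G x y) (G x z)
        ≤ min (((N + 1 : ℕ) : ℝ≥0∞) * G y x) (((N + 1 : ℕ) : ℝ≥0∞) * G z x) :=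
          min_le_min (hsymm x hx y hy) (hsymm x hx z hz)
      _ = ((N + 1 : ℕ) : ℝ≥0∞) * min (G y x) (G z x) := (mul_min _ _ _).symm
      _ ≤ ((N + 1 : ℕ) : ℝ≥0∞) * (((N + 1 : ℕ) : ℝ≥0∞) * G y z) := by gcongr
      _ = _ := by rw [← mul_assoc]; push_cast; rfl

/-! ### Truncation, measurable selection and locally finite covers -/

lemma ENNReal.le_natCast_mul {C : ℕ} (hC : 1 ≤ C) (a : ℝ≥0∞) : a ≤ C * a := by
  calc a = 1 * a := (one_mul a).symm
    _ ≤ C * a := by gcongr; exact_mod_cast hC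

lemma ENNReal.iSup_min_natCast (a : ℝ≥0∞) : ⨆ K : ℕ, min a (K : ℝ≥0∞) = a := by
  refine le_antisymm (iSup_le fun K => min_le_left _ _) ?_
  refine le_of_forall_lt fun b hb => ?_
  obtain ⟨K, hK⟩ := ENNReal.exists_nat_gt hb.ne_top
  exact lt_iSup_iff.2 ⟨K, lt_min hb hK⟩

lemma iSup_lintegral_min_natCast {α : Type*} [MeasurableSpace α] {ν : Measure α} {g : α → ℝ≥0∞}
    (hg : Measurable g) : ⨆ K : ℕ, ∫⁻ y, min (g y) (K : ℝ≥0∞) ∂ν = ∫⁻ y, g y ∂ν := by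
  rw [← lintegral_iSup (fun K => hg.min measurable_const)]
  · simp_rw [ENNReal.iSup_min_natCast]
  · intro K L h y
    exact min_le_min le_rfl (by exact_mod_cast h)

lemma exists_lt_lintegral_min_natCast {α : Type*} [MeasurableSpace α] {ν : Measure α}
    {g : α → ℝ≥0∞} (hg : Measurable g) {c : ℝ≥0∞} (hc : c < ∫⁻ y, g y ∂ν) :
    ∃ K : ℕ, c < ∫⁻ y, min (g y) (K : ℝ≥0∞) ∂ν := by
  rw [← iSup_lintegral_min_natCast hg] at hc
  exact lt_iSup_iff.1 hc

/-- A measurable choice of an index of a set that contains the given point. -/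
lemma exists_measurable_index {α : Type*} [MeasurableSpace α] {D : ℕ → Set α}
    (hD : ∀ n, MeasurableSet (D n)) :
    ∃ n : α → ℕ, Measurable n ∧ ∀ z k, z ∈ D k → z ∈ D (n z) := by
  classical
  -- The second alternative gives points outside all `D j` the index `0`, so that `Nat.find` is
  -- defined everywhere.
  let p : α → ℕ → Prop := fun z k => z ∈ D k ∨ z ∉ ⋃ j, D j
  have hp : ∀ z, ∃ k, p z k := by
    intro z
    by_cases h : z ∈ ⋃ j, D j
    · obtain ⟨k, hk⟩ := mem_iUnion.1 h
      exact ⟨k, Or.inl hk⟩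
    · exact ⟨0, Or.inr h⟩
  refine ⟨fun z => Nat.find (hp z), measurable_find hp fun k => ?_, fun z k hk => ?_⟩
  · exact (hD k).union (MeasurableSet.iUnion hD).compl
  · exact (Nat.find_spec (hp z)).resolve_right fun h => h (mem_iUnion.2 ⟨k, hk⟩)

/-- An open set with prescribed neighborhoods of its points is a locally finite countable union of
open sets, each contained in one of the prescribed neighborhoods. -/
lemma IsOpen.exists_locallyFinite_cover {X : Type*} [TopologicalSpace X] [T2Space X]
    [LocallyCompactSpace X] [SecondCountableTopology X] {W : Set X} (hW : IsOpen W)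
    (B : X → Set X) (hB : ∀ w ∈ W, B w ∈ 𝓝 w) :
    ∃ D : ℕ → Set X, (∀ n, IsOpen (D n)) ∧ ⋃ n, D n = W ∧
      (∀ n, (D n).Nonempty → ∃ w ∈ W, D n ⊆ B w) ∧
      ∀ x ∈ W, ∃ O ∈ 𝓝 x, {n | (D n ∩ O).Nonempty}.Finite := by
  have : LocallyCompactSpace W := hW.locallyCompactSpace
  have hcov : ⋃ a : W, interior ((↑) ⁻¹' B a : Set W) = univ := by
    refine eq_univ_of_forall fun a => mem_iUnion.2 ⟨a, mem_interior_iff_mem_nhds.2 ?_⟩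
    exact continuous_subtype_val.continuousAt.preimage_mem_nhds (hB a a.2)
  obtain ⟨v, hvo, hvU, hvf, hvs⟩ := precise_refinement
    (fun a : W => interior ((↑) ⁻¹' B a : Set W)) (fun _ => isOpen_interior) hcov
  let ι := {a : W // (v a).Nonempty}
  have hf' : LocallyFinite (fun a : ι => v a) := hvf.comp_injective Subtype.val_injective
  have : Countable ι := by
    rw [← countable_univ_iff]
    exact hf'.countable_univ fun a => a.2
  obtain ⟨e, he⟩ := Countable.exists_injective_nat ι
  have hmem : ∀ n x, (x ∈ ⋃ a : ι, ⋃ _ : e a = n, Subtype.val '' v a) ↔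
      ∃ a : ι, e a = n ∧ x ∈ Subtype.val '' v a := fun n x => by simp
  -- Since `e` is injective, the `n`-th set is a single `v a`, or empty if `n` is not a value of
  -- `e`.
  refine ⟨fun n => ⋃ a : ι, ⋃ _ : e a = n, Subtype.val '' v a, fun n => ?_, ?_, ?_, ?_⟩
  · exact isOpen_iUnion fun a => isOpen_iUnion fun _ => hW.isOpenMap_subtype_val _ (hvo a)
  · ext x
    rw [mem_iUnion]
    constructor
    · rintro ⟨n, hn⟩
      obtain ⟨a, -, y, -, rfl⟩ := (hmem n x).1 hn
      exact y.2
    · intro hx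
      have : (⟨x, hx⟩ : W) ∈ ⋃ a, v a := hvU ▸ mem_univ _
      obtain ⟨a, ha⟩ := mem_iUnion.1 this
      exact ⟨e ⟨a, ⟨_, ha⟩⟩, (hmem _ x).2 ⟨⟨a, ⟨_, ha⟩⟩, rfl, _, ha, rfl⟩⟩
  · rintro n ⟨x, hx⟩
    obtain ⟨a, ha, -⟩ := (hmem n x).1 hx
    refine ⟨a.1, a.1.2, fun y hy => ?_⟩
    obtain ⟨b, hb, z, hz, rfl⟩ := (hmem n y).1 hy
    obtain rfl : b = a := he (hb.trans ha.symm)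
    exact interior_subset (s := ((↑) ⁻¹' B b : Set W)) (hvs b hz)
  · intro x hx
    obtain ⟨t, ht, htf⟩ := hf' ⟨x, hx⟩
    refine ⟨Subtype.val '' t, hW.isOpenMap_subtype_val.image_mem_nhds ht, ?_⟩
    refine (htf.image e).subset ?_
    rintro n ⟨y, hy, z', hz', hzz⟩
    obtain ⟨a, ha, z, hz, rfl⟩ := (hmem n y).1 hy
    obtain rfl : z' = z := Subtype.val_injective hzz
    exact ⟨a, ⟨z', hz, hz'⟩, ha⟩

/-- Pointwise, `min (G x z) K ≤ min (G x z) (G x y) ≤ C * G y z`. This is the substitute for lower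
semicontinuity. -/
lemma lintegral_min_le_of_le_kernel {X : Type*} [MeasurableSpace X]
    {G : X → X → ℝ≥0∞} {T : Set X} {C : ℕ} (hT : QuasiMetricOn G T C)
    {ν : Measure X} (hν : ν Tᶜ = 0) {x y : X} (hx : x ∈ T) (hy : y ∈ T) {K : ℕ}
    (hK : (K : ℝ≥0∞) ≤ G x y) :
    ∫⁻ z, min (G x z) K ∂ν ≤ C * ∫⁻ z, min (G y z) K ∂ν := by
  rw [← lintegral_const_mul' _ _ (ENNReal.natCast_ne_top C)]
  refine lintegral_mono_ae ?_
  filter_upwards [measure_eq_zero_iff_ae_notMem.1 hν] with z hz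
  have hz : z ∈ T := by simpa using hz
  rw [mul_min]
  refine le_min ?_ ((min_le_right _ _).trans (ENNReal.le_natCast_mul hT.one_le _))
  refine le_trans ?_ (hT.tri x hx y hy z hz)
  rw [min_comm]
  exact min_le_min hK le_rfl

/-! ### Local behavior of the kernel -/

section Kernel

variable {X : Type*} [TopologicalSpace X] [MeasurableSpace X] {G : X → X → ℝ≥0∞}

lemma IsPotentialKernel.measurable_section (hG : IsPotentialKernel G) (x : X) :
    Measurable (G x) :=
  hG.measurable.comp (measurable_const.prodMk measurable_id)

lemma IsPotentialKernel.potential_lt_top (hG : IsPotentialKernel G) {μ : Measure X}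
    [IsFiniteMeasure μ] {x : X} {N : Set X} (hN : N ∈ 𝓝 x) (hμ : μ N = 0) :
    potential G μ x < ∞ := by
  obtain ⟨M, hM⟩ := hG.bounded x N hN
  calc potential G μ x ≤ ∫⁻ _, M ∂μ := by
        refine lintegral_mono_ae ?_
        filter_upwards [measure_eq_zero_iff_ae_notMem.1 hμ] with y hy using hM y hy
    _ = M * μ univ := lintegral_const _
    _ < ∞ := ENNReal.mul_lt_top ENNReal.coe_lt_top (measure_lt_top _ _)

/-- Mass away from `x` contributes a finite amount, so poles of potentials are a local matter. -/
lemma IsPotentialKernel.setLIntegral_eq_top (hG : IsPotentialKernel G) [OpensMeasurableSpace X]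
    {μ : Measure X} [IsFiniteMeasure μ] {x : X} {N : Set X} (hN : N ∈ 𝓝 x)
    (hμ : potential G μ x = ∞) : ∫⁻ y in N, G x y ∂μ = ∞ := by
  obtain ⟨O, hON, hO, hxO⟩ := mem_nhds_iff.1 hN
  by_contra hne
  have h1 : ∫⁻ y in O, G x y ∂μ ≠ ∞ :=
    ne_top_of_le_ne_top hne (lintegral_mono_set hON)
  have h2 : ∫⁻ y in Oᶜ, G x y ∂μ < ∞ :=
    hG.potential_lt_top (μ := μ.restrict Oᶜ) (hO.mem_nhds hxO)
      (by rw [Measure.restrict_apply hO.measurableSet]; simp)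
  rw [potential, ← lintegral_add_compl _ hO.measurableSet] at hμ
  exact (ENNReal.add_lt_top.2 ⟨h1.lt_top, h2⟩).ne hμ

/-- Around a point `w` of an open set `N`, a neighborhood on which `G` is large, and inside which
points may be moved without increasing `G(x, ·)` much, as long as `x ∉ N`. -/
lemma IsPotentialKernel.exists_small_nhds (hG : IsPotentialKernel G) {T : Set X} {C : ℕ}
    (hT : QuasiMetricOn G T C) {N : Set X} (hN : IsOpen N) (hNT : N ⊆ T) {w : X} (hw : w ∈ N)
    (K : ℕ) :
    ∃ B, IsOpen B ∧ w ∈ B ∧ B ⊆ N ∧ ∀ z ∈ B, ∀ q ∈ B, (K : ℝ≥0∞) ≤ G z q ∧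
      ∀ x ∈ T, x ∉ N → G x q ≤ (C ^ 3 : ℕ) * G x z := by
  obtain ⟨M', hM'⟩ := hG.bounded w N (hN.mem_nhds hw)
  obtain ⟨M, hM⟩ := exists_nat_gt M'
  have hMN : ∀ y ∉ N, G w y ≤ (M : ℝ≥0∞) := fun y hy =>
    (hM' y hy).trans (by exact_mod_cast hM.le)
  have hC0 : (C : ℝ≥0∞) ≠ 0 := by
    have := hT.one_le
    exact_mod_cast (by omega : C ≠ 0)
  have hCt : (C : ℝ≥0∞) ≠ ∞ := ENNReal.natCast_ne_top C
  -- The summand `C * K` yields `K ≤ G z q` on `B`. The rest exceeds `C ^ 3 * M`, which excludes the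
  -- first case of the dichotomy for `x ∉ N` below.
  let L : ℕ := C * K + (C ^ 4 * M + 1)
  have hL : ∀ᶠ y in 𝓝 w, (L : ℝ≥0∞) < G w y :=
    (hG.tendsto w).eventually (lt_mem_nhds (ENNReal.natCast_lt_top L))
  have hwT := hNT hw
  refine ⟨interior ({y | (L : ℝ≥0∞) < G w y} ∩ N), isOpen_interior,
    mem_interior_iff_mem_nhds.2 (inter_mem hL (hN.mem_nhds hw)),
    interior_subset.trans inter_subset_right, ?_⟩
  intro z hz q hq
  obtain ⟨hzL, hzN⟩ := interior_subset hz
  obtain ⟨hqL, hqN⟩ := interior_subset hq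
  have hzT := hNT hzN
  have hqT := hNT hqN
  simp only [mem_ofPred_eq] at hzL hqL
  have hLzq : (L : ℝ≥0∞) ≤ C * G z q :=
    (le_min hzL.le hqL.le).trans (hT.tri w hwT z hzT q hqT)
  have hLqz : (L : ℝ≥0∞) ≤ C * G q z :=
    (le_min hqL.le hzL.le).trans (hT.tri w hwT q hqT z hzT)
  refine ⟨?_, ?_⟩
  · have : (C : ℝ≥0∞) * K ≤ C * G z q := by
      refine le_trans ?_ hLzq
      exact_mod_cast Nat.le_add_right _ _
    exact (ENNReal.mul_le_mul_iff_right hC0 hCt).1 this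
  · intro x hxT hxN
    rcases min_le_iff.1 (hT.tri q hqT z hzT x hxT) with h | h
    · exfalso
      have h1 : (L : ℝ≥0∞) ≤ C * (C * G z x) := hLqz.trans (by gcongr)
      have h2 : G z w ≤ C * G w x ∨ G z x ≤ C * G w x :=
        min_le_iff.1 (hT.tri z hzT w hwT x hxT)
      have h3 : G w x ≤ M := hMN x hxN
      have h4 : (L : ℝ≥0∞) ≤ C * (C * (C * M)) := by
        rcases h2 with h2 | h2
        · calc (L : ℝ≥0∞) ≤ G w z := hzL.le
            _ ≤ C * G z w := hT.symm w hwT z hzT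
            _ ≤ C * (C * M) := by gcongr; exact h2.trans (by gcongr)
            _ ≤ _ := by
              gcongr
              exact ENNReal.le_natCast_mul hT.one_le _
        · exact h1.trans (by gcongr; exact h2.trans (by gcongr))
      have h5 : L ≤ C * (C * (C * M)) := by exact_mod_cast h4
      have h6 : C * (C * (C * M)) ≤ C ^ 4 * M := by
        calc C * (C * (C * M)) = C ^ 3 * M := by ring
          _ ≤ C ^ 4 * M := Nat.mul_le_mul_right _ (Nat.pow_le_pow_right hT.one_le (by omega))
      simp only [L] at h5
      omega
    · calc G x q ≤ C * G q x := hT.symm x hxT q hqT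
        _ ≤ C * (C * G z x) := by gcongr
        _ ≤ C * (C * (C * G x z)) := by gcongr; exact hT.symm z hzT x hxT
        _ = _ := by push_cast; ring

end Kernel

/-! ### The truncation scale -/

section Scale

variable {X : Type*} [MeasurableSpace X] {G : X → X → ℝ≥0∞}

lemma measurable_kernel_section (hG : Measurable fun p : X × X => G p.1 p.2) (x : X) :
    Measurable (G x) :=
  hG.comp (measurable_const.prodMk measurable_id)

lemma measurable_potential (hG : Measurable fun p : X × X => G p.1 p.2) (ν : Measure X)
    [SFinite ν] : Measurable (potential G ν) :=
  hG.lintegral_prod_right'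

lemma measurable_lintegral_min (hG : Measurable fun p : X × X => G p.1 p.2) (ν : Measure X)
    [SFinite ν] (k : ℝ≥0∞) : Measurable fun z => ∫⁻ y, min (G z y) k ∂ν :=
  (hG.min measurable_const).lintegral_prod_right'

lemma measurable_setLIntegral_tail (hG : Measurable fun p : X × X => G p.1 p.2) (ν : Measure X)
    [SFinite ν] (k : ℝ≥0∞) : Measurable fun z => ∫⁻ y in {y | k ≤ G z y}, G z y ∂ν := by
  have h : ∀ z, ∫⁻ y in {y | k ≤ G z y}, G z y ∂ν =
      ∫⁻ y, ({p : X × X | k ≤ G p.1 p.2}.indicator fun p => G p.1 p.2) (z, y) ∂ν := by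
    intro z
    rw [← lintegral_indicator (measurableSet_le measurable_const (measurable_kernel_section hG z))]
    rfl
  simp_rw [h]
  exact (hG.indicator (measurableSet_le measurable_const hG)).lintegral_prod_right'

lemma tendsto_setLIntegral_tail {g : X → ℝ≥0∞} (hg : Measurable g) {ν : Measure X}
    (hfin : ∫⁻ y, g y ∂ν ≠ ∞) :
    Tendsto (fun K : ℕ => ∫⁻ y in {y | (K : ℝ≥0∞) ≤ g y}, g y ∂ν) atTop (𝓝 0) := by
  have hm : ∀ K : ℕ, MeasurableSet {y | (K : ℝ≥0∞) ≤ g y} := fun K =>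
    measurableSet_le measurable_const hg
  simp_rw [← lintegral_indicator (hm _)]
  have := tendsto_lintegral_of_dominated_convergence (μ := ν)
    (F := fun K : ℕ => {y | (K : ℝ≥0∞) ≤ g y}.indicator g) (f := fun _ => 0) g
    (fun K => hg.indicator (hm K))
    (fun K => Eventually.of_forall fun y => indicator_le_self _ _ y) hfin ?_
  · simpa using this
  filter_upwards [ae_lt_top hg hfin] with y hy
  obtain ⟨K, hK⟩ := ENNReal.exists_nat_gt hy.ne
  refine tendsto_const_nhds.congr' ?_
  filter_upwards [eventually_ge_atTop K] with L hL
  refine (indicator_of_notMem ?_ _).symm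
  have : (K : ℝ≥0∞) ≤ L := by exact_mod_cast hL
  exact fun h => absurd (this.trans h) (not_le.2 hK)

/-- An Egorov argument: tails of a convergent integral tend to zero, so the exceptional sets
decrease to the empty set as `K` grows. -/
lemma exists_measure_tail_le (hG : Measurable fun p : X × X => G p.1 p.2) (ν : Measure X)
    [IsFiniteMeasure ν] {ε : ℝ≥0∞} (hε : 0 < ε) :
    ∃ K : ℕ, ν {z | potential G ν z < ∞ ∧ ε < ∫⁻ y in {y | (K : ℝ≥0∞) ≤ G z y}, G z y ∂ν}
      ≤ ε := by
  let s : ℕ → Set X := fun K =>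
    {z | potential G ν z < ∞ ∧ ε < ∫⁻ y in {y | (K : ℝ≥0∞) ≤ G z y}, G z y ∂ν}
  have hs : ∀ K, MeasurableSet (s K) := fun K =>
    (measurableSet_lt (measurable_potential hG ν) measurable_const).inter
      (measurableSet_lt measurable_const (measurable_setLIntegral_tail hG ν _))
  have hanti : Antitone s := by
    rintro K L hKL z ⟨h1, h2⟩
    refine ⟨h1, h2.trans_le (lintegral_mono_set fun y hy => ?_)⟩
    have : (K : ℝ≥0∞) ≤ L := by exact_mod_cast hKL
    exact this.trans hy
  have hempty : ⋂ K, s K = ∅ := by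
    refine eq_empty_of_forall_notMem fun z hz => ?_
    rw [mem_iInter] at hz
    have h0 := tendsto_setLIntegral_tail (measurable_kernel_section hG z) (hz 0).1.ne
    obtain ⟨K, hK⟩ := (h0.eventually (gt_mem_nhds hε)).exists
    exact lt_asymm hK (hz K).2
  have := tendsto_measure_iInter_atTop (μ := ν) (fun K => (hs K).nullMeasurableSet) hanti
    ⟨0, measure_ne_top _ _⟩
  rw [hempty, measure_empty] at this
  obtain ⟨K, hK⟩ := (this.eventually (gt_mem_nhds hε)).exists
  exact ⟨K, hK.le⟩

/-- A point violating the conclusion lies, for every `m`, in an exceptional set of measure at most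
`2⁻¹ ^ m`. -/
lemma exists_tail_levels (hG : Measurable fun p : X × X => G p.1 p.2) (ν : Measure X)
    [IsFiniteMeasure ν] :
    ∃ K : ℕ → ℕ, ∀ᵐ z ∂ν, potential G ν z < ∞ →
      ∃ m, ∫⁻ y in {y | (K m : ℝ≥0∞) ≤ G z y}, G z y ∂ν ≤ 2⁻¹ ^ m := by
  have hpos : ∀ m : ℕ, (0 : ℝ≥0∞) < 2⁻¹ ^ m := fun m =>
    ENNReal.pow_pos (by simp) m
  choose K hK using fun m => exists_measure_tail_le hG ν (hpos m)
  refine ⟨K, ?_⟩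
  rw [ae_iff]
  refine le_antisymm (ge_of_tendsto' (ENNReal.tendsto_pow_atTop_nhds_zero_of_lt_one
    (r := 2⁻¹) (by simp)) fun m => ?_) (zero_le)
  refine (measure_mono fun z hz => ?_).trans (hK m)
  rw [mem_ofPred_eq] at hz
  push Not at hz
  exact ⟨hz.1, hz.2 m⟩

/-- If the potential of `ν` is uniformly integrable at the points of `E`, then the part of `ν` on
`E` whose distance from `x` is small contributes little to the potential at `x`. -/
lemma setLIntegral_le_of_tail_le {T : Set X} {C : ℕ} (hT : QuasiMetricOn G T C)
    (hG : Measurable fun p : X × X => G p.1 p.2) {ν : Measure X} {x : X} (hx : x ∈ T)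
    {E : Set X} (hE : MeasurableSet E) (hET : E ⊆ T) {K : ℕ} {ε : ℝ≥0∞}
    (htail : ∀ z ∈ E, ∫⁻ y in {y | (K : ℝ≥0∞) ≤ G z y}, G z y ∂ν ≤ ε)
    (hEx : ∀ y ∈ E, ((2 * C * K : ℕ) : ℝ≥0∞) ≤ G x y) :
    ∫⁻ y in E, G x y ∂ν ≤ (2 * C : ℕ) * ε := by
  have hC0 : ((2 * C : ℕ) : ℝ≥0∞) ≠ 0 := by
    have := hT.one_le
    exact_mod_cast (by omega : 2 * C ≠ 0)
  have hCt : ((2 * C : ℕ) : ℝ≥0∞) ≠ ∞ := ENNReal.natCast_ne_top _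
  rw [← iSup_lintegral_min_natCast (measurable_kernel_section hG x)]
  refine iSup_le fun N' => ?_
  rcases E.eq_empty_or_nonempty with rfl | ⟨y₀, hy₀⟩
  · simp
  let N := max N' (max (2 * C * K) 1)
  have hNN : (N' : ℝ≥0∞) ≤ N := by exact_mod_cast le_max_left _ _
  have hKN : ((2 * C * K : ℕ) : ℝ≥0∞) ≤ N := by
    exact_mod_cast (le_max_left _ _).trans (le_max_right N' _)
  -- `z` is a point of `E` almost closest to `x`. Truncating at `N` keeps the supremum finite, so
  -- that half of it is exceeded. By the triangle inequality `G x y` is then dominated by `G z y`,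
  -- and the tail at `z` applies.
  obtain ⟨z, hzE, hz⟩ : ∃ z ∈ E, ∀ y ∈ E, min (G x y) N ≤ 2 * G x z := by
    by_cases h0 : ⨆ y ∈ E, min (G x y) (N : ℝ≥0∞) = 0
    · refine ⟨y₀, hy₀, fun y hy => ?_⟩
      have := le_iSup₂_of_le (f := fun y (_ : y ∈ E) => min (G x y) (N : ℝ≥0∞)) y hy le_rfl
      rw [h0] at this
      exact this.trans (zero_le)
    · have hlt : (⨆ y ∈ E, min (G x y) (N : ℝ≥0∞)) / 2 < ⨆ y ∈ E, min (G x y) (N : ℝ≥0∞) := by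
        refine ENNReal.half_lt_self h0 (ne_top_of_le_ne_top (ENNReal.natCast_ne_top N) ?_)
        exact iSup₂_le fun y _ => min_le_right _ _
      obtain ⟨z, hz⟩ := lt_iSup_iff.1 hlt
      obtain ⟨hzE, hz⟩ := lt_iSup_iff.1 hz
      refine ⟨z, hzE, fun y hy => ?_⟩
      have h1 := le_iSup₂_of_le (f := fun y (_ : y ∈ E) => min (G x y) (N : ℝ≥0∞)) y hy le_rfl
      refine h1.trans ?_
      rw [mul_comm, ← ENNReal.div_le_iff (by simp) (by simp)]
      exact hz.le.trans (min_le_left _ _)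
  have key : ∀ y ∈ E, min (G x y) N ≤ (2 * C : ℕ) * G z y := by
    intro y hy
    calc min (G x y) N ≤ min (2 * G x z) (2 * G x y) := by
          refine le_min (hz y hy) ((min_le_left _ _).trans ?_)
          exact_mod_cast ENNReal.le_natCast_mul (by norm_num : 1 ≤ 2) (G x y)
      _ = 2 * min (G x z) (G x y) := (mul_min _ _ _).symm
      _ ≤ 2 * (C * G z y) := by gcongr; exact hT.tri x hx z (hET hzE) y (hET hy)
      _ = _ := by push_cast; ring
  have hsub : E ⊆ {y | (K : ℝ≥0∞) ≤ G z y} := by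
    intro y hy
    have h1 : ((2 * C : ℕ) : ℝ≥0∞) * K ≤ (2 * C : ℕ) * G z y := by
      refine le_trans ?_ (key y hy)
      exact_mod_cast le_min (hEx y hy) hKN
    exact (ENNReal.mul_le_mul_iff_right hC0 hCt).1 h1
  calc ∫⁻ y in E, min (G x y) N' ∂ν
      ≤ ∫⁻ y in E, (2 * C : ℕ) * G z y ∂ν :=
        setLIntegral_mono' hE fun y hy => (min_le_min le_rfl hNN).trans (key y hy)
    _ = (2 * C : ℕ) * ∫⁻ y in E, G z y ∂ν := lintegral_const_mul' _ _ hCt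
    _ ≤ (2 * C : ℕ) * ∫⁻ y in {y | (K : ℝ≥0∞) ≤ G z y}, G z y ∂ν := by
        gcongr
    _ ≤ _ := by gcongr; exact htail z hzE

/-- A measurable scale `κ` such that truncating `G(x, y)` at `κ(y)` preserves a large part of the
potential at every point `x` where it is infinite. -/
lemma exists_truncation_scale {T : Set X} {C : ℕ} (hT : QuasiMetricOn G T C)
    (hTm : MeasurableSet T) (hG : Measurable fun p : X × X => G p.1 p.2) (ν : Measure X)
    [IsFiniteMeasure ν] (hν : ν Tᶜ = 0) (l : ℕ) :
    ∃ κ : X → ℕ, Measurable κ ∧ ∀ x ∈ T, potential G ν x = ∞ →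
      (l : ℝ≥0∞) ≤ (C ^ 2 : ℕ) * (∫⁻ y, min (G x y) (κ y) ∂ν + (4 * C : ℕ)) := by
  classical
  have hCt : ∀ n : ℕ, (n : ℝ≥0∞) ≠ ∞ := ENNReal.natCast_ne_top
  obtain ⟨K, hK⟩ := exists_tail_levels hG ν
  obtain ⟨k, hkm, hk⟩ := exists_measurable_index
    (D := fun k : ℕ => {z | (l : ℝ≥0∞) ≤ ∫⁻ y, min (G z y) (k : ℝ≥0∞) ∂ν})
    fun k => measurableSet_le measurable_const (measurable_lintegral_min hG ν _)
  let D : ℕ → Set X := fun m => {z | ∫⁻ y in {y | (K m : ℝ≥0∞) ≤ G z y}, G z y ∂ν ≤ 2⁻¹ ^ m}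
  have hD : ∀ m, MeasurableSet (D m) := fun m =>
    measurableSet_le (measurable_setLIntegral_tail hG ν _) measurable_const
  obtain ⟨m, hmm, hm⟩ := exists_measurable_index hD
  have hpot : MeasurableSet {z | potential G ν z = ∞} :=
    measurable_potential hG ν (measurableSet_singleton _)
  -- Where `Gν = ∞`, truncation at `κ z` leaves at least `l` of the potential at `z` itself.
  -- Elsewhere `κ` is the threshold that `setLIntegral_le_of_tail_le` requires.
  let κ : X → ℕ := fun z => if potential G ν z = ∞ then k z else 2 * C * K (m z)
  have hκ : Measurable κ :=
    Measurable.ite hpot hkm ((measurable_from_nat (f := fun i => 2 * C * K i)).comp hmm)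
  have hκ' : Measurable fun z => (κ z : ℝ≥0∞) :=
    (measurable_from_nat (f := fun i => (i : ℝ≥0∞))).comp hκ
  refine ⟨κ, hκ, fun x hx hxtop => ?_⟩
  let E : ℕ → Set X := fun i =>
    T ∩ {y | potential G ν y = ∞}ᶜ ∩ (m ⁻¹' {i} ∩ D i) ∩ {y | (κ y : ℝ≥0∞) ≤ G x y}
  have hE : ∀ i, MeasurableSet (E i) := fun i =>
    ((hTm.inter hpot.compl).inter ((hmm (measurableSet_singleton i)).inter (hD i))).inter
      (measurableSet_le hκ' (measurable_kernel_section hG x))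
  have hEi : ∀ i, ∫⁻ y in E i, G x y ∂ν ≤ (2 * C : ℕ) * 2⁻¹ ^ i := by
    intro i
    refine setLIntegral_le_of_tail_le hT hG hx (hE i) (fun y hy => hy.1.1.1)
      (fun z hz => hz.1.2.2) fun y hy => ?_
    have h1 : κ y = 2 * C * K i := by
      have h2 : m y = i := hy.1.2.1
      simp only [κ]
      have h3 : ¬ potential G ν y = ∞ := hy.1.1.2
      rw [if_neg h3, h2]
    rw [← h1]
    exact hy.2
  have hEU : ∫⁻ y in ⋃ i, E i, G x y ∂ν ≤ (4 * C : ℕ) := by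
    calc ∫⁻ y in ⋃ i, E i, G x y ∂ν ≤ ∑' i, ∫⁻ y in E i, G x y ∂ν := lintegral_iUnion_le _ _
      _ ≤ ∑' i : ℕ, ((2 * C : ℕ) : ℝ≥0∞) * 2⁻¹ ^ i := ENNReal.tsum_le_tsum hEi
      _ = (4 * C : ℕ) := by
        rw [ENNReal.tsum_mul_left, ENNReal.tsum_geometric, ENNReal.one_sub_inv_two, inv_inv]
        push_cast
        ring
  -- Truncation at `κ y` loses something only where `κ y ≤ G x y`. Points of finite potential there
  -- lose at most `4 * C` in total; at points of infinite potential `a ≤ κ y` is assumed.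
  have hmain : ∀ a : ℝ≥0∞,
      (∀ y ∈ T, potential G ν y = ∞ → (κ y : ℝ≥0∞) ≤ G x y → a ≤ κ y) →
      ∫⁻ y, min (G x y) a ∂ν ≤ ∫⁻ y, min (G x y) (κ y) ∂ν + (4 * C : ℕ) := by
    intro a ha
    refine le_trans ?_ (add_le_add le_rfl hEU)
    rw [← lintegral_indicator (MeasurableSet.iUnion hE),
      ← lintegral_add_left ((measurable_kernel_section hG x).min hκ')]
    refine lintegral_mono_ae ?_
    filter_upwards [hK, measure_eq_zero_iff_ae_notMem.1 hν] with y hy hyT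
    have hyT : y ∈ T := by simpa using hyT
    by_cases h1 : (κ y : ℝ≥0∞) ≤ G x y
    · by_cases h2 : potential G ν y = ∞
      · exact (min_le_min le_rfl (ha y hyT h2 h1)).trans le_self_add
      · obtain ⟨i, hi⟩ := hy (lt_top_iff_ne_top.2 h2)
        have hyE : y ∈ ⋃ i, E i := mem_iUnion.2 ⟨m y, ⟨⟨⟨hyT, h2⟩, rfl, hm y i hi⟩, h1⟩⟩
        rw [indicator_of_mem hyE]
        exact (min_le_left _ _).trans le_add_self
    · rw [min_eq_left (not_le.1 h1).le]
      exact (min_le_left _ _).trans le_self_add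
  -- If such `y` exist, one with minimal `κ` is taken as `z`: then `a = κ z` is admissible, and `κ z
  -- ≤ G x z` transfers the bound `l` from `z` to `x`. If there are none, `a = ∞` is admissible.
  by_cases hemp : ∃ y ∈ T, potential G ν y = ∞ ∧ (κ y : ℝ≥0∞) ≤ G x y
  · have hex : ∃ n, ∃ y ∈ T, potential G ν y = ∞ ∧ (κ y : ℝ≥0∞) ≤ G x y ∧ κ y = n := by
      obtain ⟨y, h1, h2, h3⟩ := hemp
      exact ⟨_, y, h1, h2, h3, rfl⟩
    obtain ⟨z, hzT, hztop, hzx, hzn⟩ := Nat.find_spec hex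
    have hmin : ∀ y ∈ T, potential G ν y = ∞ → (κ y : ℝ≥0∞) ≤ G x y → (κ z : ℝ≥0∞) ≤ κ y := by
      intro y h1 h2 h3
      rw [hzn]
      exact_mod_cast Nat.find_min' hex ⟨y, h1, h2, h3, rfl⟩
    have hlz : (l : ℝ≥0∞) ≤ ∫⁻ y, min (G z y) (κ z) ∂ν := by
      have h1 : (l : ℝ≥0∞) < ∫⁻ y, G z y ∂ν := by
        change _ < potential G ν z
        rw [hztop]
        exact ENNReal.natCast_lt_top l
      obtain ⟨j, hj⟩ := exists_lt_lintegral_min_natCast (measurable_kernel_section hG z) h1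
      have h2 := hk z j hj.le
      have h3 : κ z = k z := if_pos hztop
      rw [h3]
      exact h2
    calc (l : ℝ≥0∞) ≤ ∫⁻ y, min (G z y) (κ z) ∂ν := hlz
      _ ≤ ∫⁻ y, (C ^ 2 : ℕ) * min (G x y) (κ z) ∂ν := by
        refine lintegral_mono_ae ?_
        filter_upwards [measure_eq_zero_iff_ae_notMem.1 hν] with y hyT
        have hyT : y ∈ T := by simpa using hyT
        have hC2 : 1 ≤ C ^ 2 := Nat.one_le_pow _ _ hT.one_le
        rw [mul_min]
        refine le_min ?_ ((min_le_right _ _).trans (ENNReal.le_natCast_mul hC2 _))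
        calc min (G z y) (κ z) ≤ min (C * G z y) (C * G z x) :=
              min_le_min (ENNReal.le_natCast_mul hT.one_le _)
                (hzx.trans (hT.symm x hx z hzT))
          _ = C * min (G z x) (G z y) := by rw [← mul_min, min_comm]
          _ ≤ C * (C * G x y) := by gcongr; exact hT.tri z hzT x hx y hyT
          _ = _ := by push_cast; ring
      _ = (C ^ 2 : ℕ) * ∫⁻ y, min (G x y) (κ z) ∂ν := lintegral_const_mul' _ _ (hCt _)
      _ ≤ _ := by gcongr; exact hmain _ hmin
  · have h1 := hmain ∞ fun y h1 h2 h3 => absurd ⟨y, h1, h2, h3⟩ hemp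
    simp only [min_top_right] at h1
    have h2 : ∫⁻ y, min (G x y) (κ y) ∂ν + (4 * C : ℕ) = ∞ := top_le_iff.1 (hxtop ▸ h1)
    rw [h2, ENNReal.mul_top]
    · exact le_top
    · have := hT.one_le
      exact_mod_cast pow_ne_zero 2 (by omega : C ≠ 0)

end Scale

lemma potential_smul {X : Type*} [MeasurableSpace X] {G : X → X → ℝ≥0∞}
    (c : ℝ≥0∞) (μ : Measure X) (x : X) :
    potential G (c • μ) x = c * potential G μ x := by
  rw [potential, lintegral_smul_measure]
  rfl

lemma potential_sum {X : Type*} [MeasurableSpace X] {G : X → X → ℝ≥0∞} {ι : Type*}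
    (μ : ι → Measure X) (x : X) :
    potential G (Measure.sum μ) x = ∑' i, potential G (μ i) x :=
  lintegral_sum_measure _ _

/-! ### Moving a measure to a given sequence -/

section Discretization

variable {X : Type*} [TopologicalSpace X] [MeasurableSpace X] {G : X → X → ℝ≥0∞}

/-- Points `z` may be moved to points `φ z` of a given sequence so that truncations of `G(x, ·)` at
the scale `κ` do not decrease much at the points `x` of the closure of the sequence. -/
lemma IsPotentialKernel.exists_moving_map (hG : IsPotentialKernel G) {T : Set X} {C : ℕ}
    (hT : QuasiMetricOn G T C) {p : ℕ → X} (hp : ∀ j, p j ∈ T) {κ : X → ℕ} (hκ : Measurable κ) :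
    ∃ φ : X → X, Measurable φ ∧ (∀ z, φ z ∈ range p) ∧
      ∀ x ∈ T, x ∈ closure (range p) → ∀ z ∈ T,
        min (G x z) (κ z) ≤ (2 * C ^ 4 : ℕ) * G x (φ z) := by
  have hs : ∀ q, Measurable fun z => G z q := fun q =>
    hG.measurable.comp (measurable_id.prodMk measurable_const)
  have hκ' : Measurable fun z => (κ z : ℝ≥0∞) :=
    (measurable_from_nat (f := fun i => (i : ℝ≥0∞))).comp hκ
  -- The supremum may be infinite; capped at `κ z`, it is reached up to a factor `2` by some `p j`.
  obtain ⟨j, hjm, hj⟩ := exists_measurable_index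
    (D := fun j => {z | min (κ z : ℝ≥0∞) (⨆ i, G z (p i)) ≤ 2 * G z (p j)})
    fun j => measurableSet_le (hκ'.min (Measurable.iSup fun i => hs _))
      ((hs _).const_mul _)
  have hj' : ∀ z, min (κ z : ℝ≥0∞) (⨆ i, G z (p i)) ≤ 2 * G z (p (j z)) := by
    intro z
    by_cases h0 : min (κ z : ℝ≥0∞) (⨆ i, G z (p i)) = 0
    · rw [h0]
      exact zero_le
    have hlt := ENNReal.half_lt_self h0
      (ne_top_of_le_ne_top (ENNReal.natCast_ne_top (κ z)) (min_le_left _ _))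
    obtain ⟨i, hi⟩ := lt_iSup_iff.1 (hlt.trans_le (min_le_right _ _))
    refine hj z i ?_
    rw [mem_ofPred_eq, mul_comm, ← ENNReal.div_le_iff (by simp) (by simp)]
    exact hi.le
  refine ⟨fun z => p (j z), (measurable_from_nat (f := p)).comp hjm, fun z => mem_range_self _, ?_⟩
  intro x hx hxcl z hz
  obtain ⟨_, ⟨i, rfl⟩, hi⟩ := ((mem_closure_iff_frequently.1 hxcl).and_eventually
    ((hG.tendsto x).eventually (lt_mem_nhds (ENNReal.natCast_lt_top (κ z))))).exists
  have h1 : min (G x z) (κ z) ≤ (C ^ 2 : ℕ) * ⨆ i, G z (p i) :=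
    calc min (G x z) (κ z) ≤ min (G x (p i)) (G x z) := by
          rw [min_comm]; exact min_le_min hi.le le_rfl
      _ ≤ C * G (p i) z := hT.tri x hx _ (hp i) z hz
      _ ≤ C * (C * G z (p i)) := by gcongr; exact hT.symm _ (hp i) z hz
      _ = (C ^ 2 : ℕ) * G z (p i) := by push_cast; ring
      _ ≤ _ := by gcongr; exact le_iSup (fun i => G z (p i)) i
  have hC2 : 1 ≤ C ^ 2 := Nat.one_le_pow _ _ hT.one_le
  have h2 : min (G x z) (κ z) ≤ (2 * C ^ 2 : ℕ) * G z (p (j z)) :=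
    calc min (G x z) (κ z) ≤ (C ^ 2 : ℕ) * min (κ z : ℝ≥0∞) (⨆ i, G z (p i)) := by
          rw [mul_min]
          exact le_min ((min_le_right _ _).trans (ENNReal.le_natCast_mul hC2 _)) h1
      _ ≤ (C ^ 2 : ℕ) * (2 * G z (p (j z))) := by gcongr; exact hj' z
      _ = _ := by push_cast; ring
  have h3 : min (G x z) (κ z) ≤ (2 * C ^ 2 : ℕ) * G z x := by
    refine (min_le_left _ _).trans ((hT.symm x hx z hz).trans ?_)
    gcongr
    nlinarith [hT.one_le]
  calc min (G x z) (κ z) ≤ (2 * C ^ 2 : ℕ) * min (G z x) (G z (p (j z))) := by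
        rw [mul_min]
        exact le_min h3 h2
    _ ≤ (2 * C ^ 2 : ℕ) * (C * G x (p (j z))) := by
        gcongr; exact hT.tri z hz x hx _ (hp _)
    _ ≤ (2 * C ^ 2 : ℕ) * (C * (C * G x (p (j z)))) := by
        gcongr; exact ENNReal.le_natCast_mul hT.one_le _
    _ = _ := by push_cast; ring

/-- The image of `ν` under the moving map works. The level given to the scale compensates the factor
`C ^ 2`, the loss `4 * C` and the factor `2 * C ^ 4`. The mass does not depend on `l`, which permits
the superposition below. -/
lemma IsPotentialKernel.exists_discrete_measure_le_potential (hG : IsPotentialKernel G)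
    {T : Set X} {C : ℕ} (hT : QuasiMetricOn G T C) (hTm : MeasurableSet T) {ν : Measure X}
    [IsFiniteMeasure ν] (hν : ν Tᶜ = 0) {p : ℕ → X} (hp : ∀ j, p j ∈ T)
    (hpm : MeasurableSet (range p)) (l : ℕ) :
    ∃ μ : Measure X, μ univ = ν univ ∧ μ (range p)ᶜ = 0 ∧
      ∀ x ∈ T, x ∈ closure (range p) → potential G ν x = ∞ → (l : ℝ≥0∞) ≤ potential G μ x := by
  obtain ⟨κ, hκ, hκl⟩ := exists_truncation_scale hT hTm hG.measurable ν hν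
    (C ^ 2 * (2 * C ^ 4 * l + 4 * C))
  obtain ⟨φ, hφ, hφp, hφG⟩ := hG.exists_moving_map hT hp hκ
  refine ⟨ν.map φ, ?_, ?_, fun x hx hxcl hxtop => ?_⟩
  · rw [Measure.map_apply hφ MeasurableSet.univ, preimage_univ]
  · rw [Measure.map_apply hφ hpm.compl]
    have : φ ⁻¹' (range p)ᶜ = ∅ := eq_empty_of_forall_notMem fun z hz => hz (hφp z)
    rw [this, measure_empty]
  have hC := hT.one_le
  have hne : ∀ {n : ℕ}, n ≠ 0 → (n : ℝ≥0∞) ≠ 0 := fun h => by exact_mod_cast h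
  have h1 := hκl x hx hxtop
  rw [Nat.cast_mul, ENNReal.mul_le_mul_iff_right (hne (by positivity)) (ENNReal.natCast_ne_top _),
    Nat.cast_add, ENNReal.add_le_add_iff_right (ENNReal.natCast_ne_top _)] at h1
  have h2 : ∫⁻ y, min (G x y) (κ y) ∂ν ≤ (2 * C ^ 4 : ℕ) * potential G (ν.map φ) x := by
    rw [potential, lintegral_map (hG.measurable_section x) hφ,
      ← lintegral_const_mul' _ _ (ENNReal.natCast_ne_top _)]
    refine lintegral_mono_ae ?_
    filter_upwards [measure_eq_zero_iff_ae_notMem.1 hν] with y hyT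
    exact hφG x hx hxcl y (by simpa using hyT)
  have h3 := h1.trans h2
  rwa [Nat.cast_mul (2 * C ^ 4) l,
    ENNReal.mul_le_mul_iff_right (hne (by positivity)) (ENNReal.natCast_ne_top _)] at h3

/-- A measure carried by a prescribed sequence whose potential is infinite at the points of the
closure of the sequence where the potential of `ν` is infinite. -/
lemma IsPotentialKernel.exists_discrete_measure_potential_eq_top (hG : IsPotentialKernel G)
    {T : Set X} {C : ℕ} (hT : QuasiMetricOn G T C) (hTm : MeasurableSet T) {ν : Measure X}
    [IsFiniteMeasure ν] (hν : ν Tᶜ = 0) {p : ℕ → X} (hp : ∀ j, p j ∈ T)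
    (hpm : MeasurableSet (range p)) :
    ∃ μ : Measure X, IsFiniteMeasure μ ∧ μ (range p)ᶜ = 0 ∧
      ∀ x ∈ T, x ∈ closure (range p) → potential G ν x = ∞ → potential G μ x = ∞ := by
  choose μ hμ1 hμ2 hμ3 using fun n : ℕ =>
    hG.exists_discrete_measure_le_potential hT hTm hν hp hpm (2 ^ n * n)
  refine ⟨Measure.sum fun n => (2⁻¹ : ℝ≥0∞) ^ n • μ n, ⟨?_⟩, ?_, fun x hx hxcl hxtop => ?_⟩
  · rw [Measure.sum_apply _ MeasurableSet.univ]
    simp only [Measure.smul_apply, smul_eq_mul, hμ1]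
    rw [ENNReal.tsum_mul_right, ENNReal.tsum_geometric, ENNReal.one_sub_inv_two, inv_inv]
    exact ENNReal.mul_lt_top (by simp) (measure_lt_top _ _)
  · rw [Measure.sum_apply _ hpm.compl]
    simp [hμ2]
  · rw [potential_sum]
    refine ENNReal.eq_top_of_forall_nnreal_le fun r => ?_
    obtain ⟨n, hn⟩ := exists_nat_ge r
    refine le_trans ?_ (ENNReal.le_tsum n)
    rw [potential_smul]
    calc (r : ℝ≥0∞) ≤ (n : ℝ≥0) := by exact_mod_cast hn
      _ = 2⁻¹ ^ n * ((2 ^ n * n : ℕ) : ℝ≥0∞) := by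
        push_cast
        rw [← mul_assoc, ← mul_pow, ENNReal.inv_mul_cancel (by simp) (by simp), one_pow, one_mul]
      _ ≤ _ := by gcongr; exact hμ3 n x hx hxcl hxtop

end Discretization

/-! ### Reweighting and locally discrete measures -/

section LocallyDiscrete

variable {X : Type*} [TopologicalSpace X] [T2Space X] [LocallyCompactSpace X]
  [SecondCountableTopology X] [MeasurableSpace X] [BorelSpace X] {G : X → X → ℝ≥0∞}

/-- A density, locally bounded below on `U`, that makes potentials bounded off `U`. -/
lemma IsPotentialKernel.exists_weight (hG : IsPotentialKernel G) {T : Set X} {C : ℕ}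
    (hT : QuasiMetricOn G T C) (hTo : IsOpen T) {U : Set X} (hU : IsOpen U) :
    ∃ f : X → ℝ≥0∞, Measurable f ∧ (∀ z, f z ≤ 1) ∧
      (∀ x ∈ T, x ∉ U → ∀ z, f z * G x z ≤ 1) ∧
      ∀ w ∈ U ∩ T, ∃ O, IsOpen O ∧ w ∈ O ∧ ∃ c : ℝ≥0∞, c ≠ 0 ∧ ∀ z ∈ O, c ≤ f z := by
  have hloc : ∀ w, ∃ B ∈ 𝓝 w, w ∈ U ∩ T → ∃ c : ℝ≥0∞, c ≤ 1 ∧ c ≠ 0 ∧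
      ∀ z ∈ B, ∀ x ∈ T, x ∉ U → c * G x z ≤ 1 := by
    intro w
    by_cases hw : w ∈ U ∩ T
    swap
    · exact ⟨univ, univ_mem, fun h => absurd h hw⟩
    obtain ⟨B, hBo, hwB, -, hB⟩ :=
      hG.exists_small_nhds hT (hU.inter hTo) inter_subset_right hw 0
    obtain ⟨M', hM'⟩ := hG.bounded w _ ((hU.inter hTo).mem_nhds hw)
    obtain ⟨M, hM⟩ := exists_nat_ge M'
    -- `C ^ 3` comes from moving `z` to `w`, another `C` from symmetry; `+ 1` keeps the constant at
    -- most `1` when `M = 0`.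
    refine ⟨B, hBo.mem_nhds hwB, fun _ => ⟨((C ^ 4 * M + 1 : ℕ) : ℝ≥0∞)⁻¹, ?_, ?_, ?_⟩⟩
    · rw [ENNReal.inv_le_one]
      exact_mod_cast Nat.le_add_left _ _
    · exact ENNReal.inv_ne_zero.2 (ENNReal.natCast_ne_top _)
    · intro z hz x hxT hxU
      have hxN : x ∉ U ∩ T := fun h => hxU h.1
      have h1 : G x z ≤ ((C ^ 4 * M + 1 : ℕ) : ℝ≥0∞) := by
        calc G x z ≤ (C ^ 3 : ℕ) * G x w := (hB w hwB z hz).2 x hxT hxN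
          _ ≤ (C ^ 3 : ℕ) * (C * G w x) := by gcongr; exact hT.symm x hxT w hw.2
          _ ≤ (C ^ 3 : ℕ) * (C * M) := by
            gcongr
            exact (hM' x hxN).trans (by exact_mod_cast hM)
          _ = (C ^ 4 * M : ℕ) := by push_cast; ring
          _ ≤ _ := by exact_mod_cast Nat.le_succ _
      calc ((C ^ 4 * M + 1 : ℕ) : ℝ≥0∞)⁻¹ * G x z
          ≤ ((C ^ 4 * M + 1 : ℕ) : ℝ≥0∞)⁻¹ * (C ^ 4 * M + 1 : ℕ) := by gcongr
        _ ≤ 1 := ENNReal.inv_mul_le_one _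
  choose B hB hBc using hloc
  obtain ⟨D, hDo, hDU, hDB, -⟩ :=
    (hU.inter hTo).exists_locallyFinite_cover B fun w _ => hB w
  have hc : ∀ n, ∃ c : ℝ≥0∞, c ≤ 1 ∧ c ≠ 0 ∧ ∀ z ∈ D n, ∀ x ∈ T, x ∉ U → c * G x z ≤ 1 := by
    intro n
    by_cases hn : (D n).Nonempty
    · obtain ⟨w, hw, hwB⟩ := hDB n hn
      obtain ⟨c, h1, h2, h3⟩ := hBc w hw
      exact ⟨c, h1, h2, fun z hz => h3 z (hwB hz)⟩
    · exact ⟨1, le_rfl, one_ne_zero, fun z hz => absurd ⟨z, hz⟩ hn⟩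
  choose c hc1 hc0 hcG using hc
  refine ⟨fun z => ⨆ n, (D n).indicator (fun _ => c n) z,
    Measurable.iSup fun n => measurable_const.indicator (hDo n).measurableSet,
    fun z => iSup_le fun n => indicator_apply_le' (fun _ => hc1 n) fun _ => zero_le, ?_, ?_⟩
  · intro x hxT hxU z
    rw [ENNReal.iSup_mul]
    refine iSup_le fun n => ?_
    by_cases hz : z ∈ D n
    · rw [indicator_of_mem hz]
      exact hcG n z hz x hxT hxU
    · simp [indicator_of_notMem hz]
  · intro w hw
    rw [← hDU] at hw
    obtain ⟨n, hn⟩ := mem_iUnion.1 hw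
    refine ⟨D n, hDo n, hn, c n, hc0 n, fun z hz => ?_⟩
    refine le_trans ?_ (le_iSup _ n)
    rw [indicator_of_mem hz]

/-- A measure `ν` on a subset `Q` of `P`, with infinite potential on `P ∩ A` and potential
less than `1` at the points of `T` off `U`, can be made locally discrete near `P ∩ A`. -/
lemma IsPotentialKernel.exists_locallyDiscrete_aux (hG : IsPotentialKernel G) {T : Set X} {C : ℕ}
    (hT : QuasiMetricOn G T C) (hTo : IsOpen T) {A P Q U : Set X} (hAT : closure A ⊆ T)
    (hQ : Q ⊆ P ∩ A) (hQm : MeasurableSet Q) {ν : Measure X}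
    [IsFiniteMeasure ν] (hνQ : ν Qᶜ = 0)
    (hνP : ∀ x ∈ P ∩ A, potential G ν x = ∞)
    (hνU : ∀ x ∈ T, x ∉ U → potential G ν x < 1) :
    ∃ μ : Measure X, μ univ ≤ ν univ ∧ μ Qᶜ = 0 ∧
      (∀ x ∈ P ∩ A, 1 ≤ (C ^ 3 : ℕ) * potential G μ x) ∧
      (∀ x ∈ T, x ∉ U → potential G μ x ≤ (C ^ 3 : ℕ) * potential G ν x) ∧
      ∀ x ∉ P, potential G μ x < ∞ := by
  classical
  have hAT' : A ⊆ T := subset_closure.trans hAT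
  have hQT : Q ⊆ T := fun x hx => hAT' (hQ hx).2
  have hνT : ν Tᶜ = 0 := measure_mono_null (compl_subset_compl.2 hQT) hνQ
  have hC := hT.one_le
  have hC0 : (C : ℝ≥0∞) ≠ 0 := by exact_mod_cast (by omega : C ≠ 0)
  have hne : ∀ n : ℕ, (n : ℝ≥0∞) ≠ ∞ := ENNReal.natCast_ne_top
  -- `W` is an open set between `P ∩ A` and the complement of `T \ U`, with one truncation level
  -- serving a whole neighborhood of each of its points.
  let W : Set X := {w | ∃ N, IsOpen N ∧ w ∈ N ∧ N ⊆ T ∧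
    ∃ K : ℕ, ∀ y ∈ N, 1 ≤ ∫⁻ z, min (G y z) (K : ℝ≥0∞) ∂ν}
  have hWo : IsOpen W := by
    refine isOpen_iff_forall_mem_open.2 ?_
    rintro w ⟨N, hN, hwN, hNT, K, hK⟩
    exact ⟨N, fun y hy => ⟨N, hN, hy, hNT, K, hK⟩, hN, hwN⟩
  have hWT : W ⊆ T := by
    rintro w ⟨N, -, hwN, hNT, -⟩
    exact hNT hwN
  have hWof : ∀ x ∈ T, (C : ℝ≥0∞) < potential G ν x → x ∈ W := by
    intro x hx hlt
    obtain ⟨K, hK⟩ := exists_lt_lintegral_min_natCast (hG.measurable_section x) hlt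
    have hnhds : {y | (K : ℝ≥0∞) < G x y} ∈ 𝓝 x :=
      (hG.tendsto x).eventually (lt_mem_nhds (ENNReal.natCast_lt_top K))
    refine ⟨interior {y | (K : ℝ≥0∞) < G x y} ∩ T, isOpen_interior.inter hTo,
      ⟨mem_interior_iff_mem_nhds.2 hnhds, hx⟩, inter_subset_right, K, ?_⟩
    rintro y ⟨hy, hyT⟩
    have hy : (K : ℝ≥0∞) < G x y := interior_subset (s := {y | (K : ℝ≥0∞) < G x y}) hy
    have h1 := hK.le.trans (lintegral_min_le_of_le_kernel hT hνT hx hyT hy.le)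
    nth_rewrite 1 [← mul_one (C : ℝ≥0∞)] at h1
    exact (ENNReal.mul_le_mul_iff_right hC0 (hne C)).1 h1
  have hPW : P ∩ A ⊆ W := fun x hx => hWof x (hAT' hx.2) (by rw [hνP x hx]; exact (hne C).lt_top)
  have hUW : ∀ x ∈ T, x ∉ U → x ∉ W := by
    rintro x hx hxU ⟨N, -, hxN, -, K, hK⟩
    have h1 : 1 ≤ potential G ν x :=
      (hK x hxN).trans (lintegral_mono fun z => min_le_left _ _)
    exact absurd h1 (not_le.2 (hνU x hx hxU))
  -- Here `k` stands for a level not above any that is sufficient at `x`. If `x ∈ N`, then `k ≤ K ≤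
  -- G z q`, and the triangle inequality applies; if `x ∉ N`, points of `B` are interchangeable for
  -- `G x`.
  have hpiece : ∀ w, ∃ B ∈ 𝓝 w, w ∈ W → ∀ z ∈ B, ∀ q ∈ B,
      (∀ x ∈ T, x ∉ W → G x q ≤ (C ^ 3 : ℕ) * G x z) ∧
      ∀ x ∈ W, ∀ k : ℕ, (∀ K : ℕ, 1 ≤ ∫⁻ z, min (G x z) (K : ℝ≥0∞) ∂ν → k ≤ K) →
        min (G x z) k ≤ (C ^ 3 : ℕ) * G x q := by
    intro w
    by_cases hw : w ∈ W
    swap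
    · exact ⟨univ, univ_mem, fun h => absurd h hw⟩
    obtain ⟨N, hN, hwN, hNT, K, hK⟩ := hw
    have hNW : N ⊆ W := fun y hy => ⟨N, hN, hy, hNT, K, hK⟩
    obtain ⟨B, hBo, hwB, hBN, hB⟩ := hG.exists_small_nhds hT hN hNT hwN K
    refine ⟨B, hBo.mem_nhds hwB, fun _ z hz q hq => ⟨fun x hxT hxW =>
      (hB z hz q hq).2 x hxT fun h => hxW (hNW h), fun x hxW k hk => ?_⟩⟩
    have hxT := hWT hxW
    by_cases hxN : x ∈ N
    · have hkK : (k : ℝ≥0∞) ≤ K := by exact_mod_cast hk K (hK x hxN)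
      have hzT := hNT (hBN hz)
      have hqT := hNT (hBN hq)
      calc min (G x z) k ≤ min (C * G z x) (C * G z q) :=
            min_le_min (hT.symm x hxT z hzT)
              ((hkK.trans (hB z hz q hq).1).trans (ENNReal.le_natCast_mul hC _))
        _ = C * min (G z x) (G z q) := (mul_min _ _ _).symm
        _ ≤ C * (C * G x q) := by gcongr; exact hT.tri z hzT x hxT q hqT
        _ ≤ C * (C * (C * G x q)) := by gcongr; exact ENNReal.le_natCast_mul hC _
        _ = _ := by push_cast; ring
    · exact (min_le_left _ _).trans ((hB q hq z hz).2 x hxT hxN)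
  choose B hB hBW using hpiece
  obtain ⟨D, hDo, hDW, hDB, hDfin⟩ := hWo.exists_locallyFinite_cover B fun w _ => hB w
  obtain ⟨n, hnm, hn⟩ := exists_measurable_index fun k => (hDo k).measurableSet
  rcases Q.eq_empty_or_nonempty with hQe | ⟨q₀, hq₀⟩
  · have hν0 : ν = 0 := by
      rw [hQe, compl_empty] at hνQ
      exact Measure.measure_univ_eq_zero.1 hνQ
    refine ⟨0, by simp, by simp, fun x hx => ?_, fun x _ _ => by simp [potential],
      fun x _ => by simp [potential]⟩
    have := hνP x hx
    simp [hν0, potential] at this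
  have hq : ∀ k, ∃ q ∈ Q, (D k ∩ Q).Nonempty → q ∈ D k := by
    intro k
    by_cases h : (D k ∩ Q).Nonempty
    · obtain ⟨q, h1, h2⟩ := h
      exact ⟨q, h2, fun _ => h1⟩
    · exact ⟨q₀, hq₀, fun h' => absurd h' h⟩
  choose q hqQ hqD using hq
  let φ : X → X := fun z => q (n z)
  have hφ : Measurable φ := (measurable_from_nat (f := q)).comp hnm
  have hQD : ∀ z ∈ Q, z ∈ D (n z) ∧ φ z ∈ D (n z) := by
    intro z hz
    have hzW : z ∈ ⋃ k, D k := hDW ▸ hPW (hQ hz)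
    obtain ⟨k, hk⟩ := mem_iUnion.1 hzW
    have h1 := hn z k hk
    exact ⟨h1, hqD _ ⟨z, h1, hz⟩⟩
  have hae : ∀ᵐ z ∂ν, z ∈ Q := by
    filter_upwards [measure_eq_zero_iff_ae_notMem.1 hνQ] with z hz
    simpa using hz
  have hpot : ∀ x, potential G (ν.map φ) x = ∫⁻ z, G x (φ z) ∂ν := fun x =>
    lintegral_map (hG.measurable_section x) hφ
  have hpairs : ∀ z ∈ Q, ∃ w ∈ W, z ∈ B w ∧ φ z ∈ B w := by
    intro z hz
    obtain ⟨h1, h2⟩ := hQD z hz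
    obtain ⟨w, hw, hwB⟩ := hDB _ ⟨z, h1⟩
    exact ⟨w, hw, hwB h1, hwB h2⟩
  have hoff : ∀ x ∈ T, x ∉ W → potential G (ν.map φ) x ≤ (C ^ 3 : ℕ) * potential G ν x := by
    intro x hxT hxW
    rw [hpot, potential, ← lintegral_const_mul' _ _ (hne _)]
    refine lintegral_mono_ae ?_
    filter_upwards [hae] with z hz
    obtain ⟨w, hw, h1, h2⟩ := hpairs z hz
    exact (hBW w hw z h1 _ h2).1 x hxT hxW
  have hmass : (ν.map φ) univ = ν univ := by
    rw [Measure.map_apply hφ MeasurableSet.univ, preimage_univ]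
  have hμfin : IsFiniteMeasure (ν.map φ) := ⟨by rw [hmass]; exact measure_lt_top _ _⟩
  have hμQ : (ν.map φ) Qᶜ = 0 := by
    rw [Measure.map_apply hφ hQm.compl]
    have : φ ⁻¹' Qᶜ = ∅ := eq_empty_of_forall_notMem fun z hz => hz (hqQ _)
    rw [this, measure_empty]
  refine ⟨ν.map φ, hmass.le, hμQ, fun x hx => ?_, fun x hxT hxU => hoff x hxT (hUW x hxT hxU),
    fun x hxP => ?_⟩
  · have hxW := hPW hx
    -- The least sufficient level at `x` suits all pieces at once.
    have hex : ∃ K : ℕ, 1 ≤ ∫⁻ z, min (G x z) (K : ℝ≥0∞) ∂ν := by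
      obtain ⟨N, -, hxN, -, K, hK⟩ := hxW
      exact ⟨K, hK x hxN⟩
    rw [hpot, ← lintegral_const_mul' _ _ (hne _)]
    refine (Nat.find_spec hex).trans (lintegral_mono_ae ?_)
    filter_upwards [hae] with z hz
    obtain ⟨w, hw, h1, h2⟩ := hpairs z hz
    exact (hBW w hw z h1 _ h2).2 x hxW _ fun K hK => Nat.find_min' hex hK
  · by_cases hxT : x ∈ T
    swap
    · refine hG.potential_lt_top (N := (closure A)ᶜ)
        (isClosed_closure.isOpen_compl.mem_nhds fun h => hxT (hAT h))
        (measure_mono_null (compl_subset_compl.2 fun y hy => subset_closure (hQ hy).2) hμQ)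
    by_cases hxW : x ∈ W
    swap
    · refine (hoff x hxT hxW).trans_lt (ENNReal.mul_lt_top (hne _).lt_top ?_)
      exact (not_lt.1 fun h => hxW (hWof x hxT h)).trans_lt (hne C).lt_top
    -- Near `x` there are only finitely many of the points carrying the image measure, and none is
    -- `x` because they lie in `P`. So a neighborhood of `x` has no mass.
    obtain ⟨O, hO, hOfin⟩ := hDfin x hxW
    have hfin : (q '' {k | (D k ∩ O).Nonempty}).Finite := hOfin.image q
    have hxq : x ∉ q '' {k | (D k ∩ O).Nonempty} := by
      rintro ⟨k, -, rfl⟩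
      exact hxP (hQ (hqQ k)).1
    have hN := inter_mem hO (hfin.isClosed.isOpen_compl.mem_nhds hxq)
    obtain ⟨V, hVN, hVo, hxV⟩ := mem_nhds_iff.1 hN
    refine hG.potential_lt_top (hVo.mem_nhds hxV) ?_
    rw [Measure.map_apply hφ hVo.measurableSet]
    refine measure_mono_null (t := Qᶜ) (fun z hz hzQ => ?_) hνQ
    have h1 := hVN hz
    exact h1.2 ⟨n z, ⟨φ z, (hQD z hzQ).2, h1.1⟩, rfl⟩

end LocallyDiscrete

/-! ### Capacity zero and infinity sets -/

lemma ENNReal.tsum_lt_top_of_le_off_finite {a b : ℕ → ℝ≥0∞} {J : Set ℕ} (hJ : J.Finite)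
    (ha : ∀ n, a n < ∞) (hab : ∀ n ∉ J, a n ≤ b n) (hb : ∑' n, b n < ∞) : ∑' n, a n < ∞ := by
  have h1 : ∑' n, a n ≤ ∑' n, (J.indicator a n + b n) := by
    refine ENNReal.tsum_le_tsum fun n => ?_
    by_cases hn : n ∈ J
    · rw [indicator_of_mem hn]
      exact le_self_add
    · exact (hab n hn).trans le_add_self
  rw [ENNReal.tsum_add] at h1
  refine h1.trans_lt (ENNReal.add_lt_top.2 ⟨?_, hb⟩)
  rw [tsum_eq_sum (s := hJ.toFinset) fun n hn =>
    indicator_of_notMem (fun h => hn (hJ.mem_toFinset.2 h)) _]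
  refine ENNReal.sum_lt_top.2 fun n _ => ?_
  exact (indicator_le_self _ _ n).trans_lt (ha n)

lemma tsum_mul_two_inv_pow_succ (δ : ℝ≥0∞) : ∑' n : ℕ, δ * 2⁻¹ ^ (n + 1) = δ := by
  rw [ENNReal.tsum_mul_left, ENNReal.tsum_geometric_add_one, ENNReal.one_sub_inv_two, inv_inv,
    ENNReal.inv_mul_cancel (by simp) (by simp), mul_one]

lemma exists_potential_eq_top_of_cStar_eq_zero {X : Type*} [MeasurableSpace X]
    {G : X → X → ℝ≥0∞} {P : Set X} (hP : cStar G P = 0) :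
    ∃ ν : Measure X, IsFiniteMeasure ν ∧ ∀ x ∈ P, potential G ν x = ∞ := by
  have h : ∀ n : ℕ, ∃ ν : Measure X, ν univ ≤ 1 * 2⁻¹ ^ (n + 1) ∧
      ∀ x ∈ P, 1 ≤ potential G ν x := by
    intro n
    have hlt : cStar G P < 1 * 2⁻¹ ^ (n + 1) := by
      rw [hP, one_mul]
      exact ENNReal.pow_pos (by simp) _
    obtain ⟨_, ⟨ν, -, hν, rfl⟩, hlt⟩ := sInf_lt_iff.1 hlt
    exact ⟨ν, hlt.le, hν⟩
  choose ν hν1 hν2 using h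
  refine ⟨Measure.sum ν, ⟨?_⟩, fun x hx => ?_⟩
  · rw [Measure.sum_apply _ MeasurableSet.univ]
    exact ((ENNReal.tsum_le_tsum hν1).trans (tsum_mul_two_inv_pow_succ 1).le).trans_lt
      ENNReal.one_lt_top
  · rw [potential_sum, ← top_le_iff, ← ENNReal.tsum_const_eq_top_of_ne_zero (α := ℕ) one_ne_zero]
    exact ENNReal.tsum_le_tsum fun n => hν2 n x hx

lemma cStar_eq_zero_of_potential_eq_top {X : Type*} [MeasurableSpace X]
    {G : X → X → ℝ≥0∞} {P : Set X} {μ : Measure X} [IsFiniteMeasure μ]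
    (hμ : ∀ x ∈ P, potential G μ x = ∞) : cStar G P = 0 := by
  refine le_antisymm (le_of_forall_gt fun ε hε => ?_) zero_le
  have hM : μ univ + 1 ≠ ∞ := by simp
  have hε' : min ε 1 / 2 ≠ 0 := by simp [hε.ne']
  have hε'' : min ε 1 / 2 ≠ ∞ := ENNReal.div_ne_top (by simp) (by simp)
  -- The minimum with `1` and the summand `1` keep `c` finite also for `ε = ∞` or `μ = 0`.
  let c : ℝ≥0∞ := (min ε 1 / 2) / (μ univ + 1)
  have hc0 : c ≠ 0 := ENNReal.div_ne_zero.2 ⟨hε', hM⟩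
  have hct : c ≠ ∞ := ENNReal.div_ne_top hε'' (by simp)
  have hcμ : c * μ univ < ε := by
    calc c * μ univ ≤ c * (μ univ + 1) := by gcongr; exact le_self_add
      _ = min ε 1 / 2 := ENNReal.div_mul_cancel (by simp) hM
      _ < min ε 1 := ENNReal.half_lt_self (by simp [hε.ne']) (by simp)
      _ ≤ ε := min_le_left _ _
  refine lt_of_le_of_lt (sInf_le ⟨c • μ, ⟨⟨?_⟩, by simp⟩, fun x hx => ?_, rfl⟩) ?_
  · rw [Measure.smul_apply, smul_eq_mul]
    exact ENNReal.mul_lt_top hct.lt_top (measure_lt_top _ _)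
  · rw [potential_smul, hμ x hx, ENNReal.mul_top hc0]
    exact le_top
  · rwa [Measure.smul_apply, smul_eq_mul]

/-- At a pole some truncated local potential exceeds `C * n`, and hence the potential is at least
`n` in a whole neighborhood. -/
lemma IsPotentialKernel.isGδ_setOf_potential_eq_top {X : Type*} [TopologicalSpace X]
    [MeasurableSpace X] [OpensMeasurableSpace X] {G : X → X → ℝ≥0∞} (hG : IsPotentialKernel G)
    (μ : Measure X) [IsFiniteMeasure μ] : IsGδ {x | potential G μ x = ∞} := by
  have h : {x | potential G μ x = ∞}
      = ⋂ n : ℕ, interior {x | (n : ℝ≥0∞) ≤ potential G μ x} := by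
    ext x
    rw [mem_iInter]
    constructor
    · intro hx n
      obtain ⟨T, hTo, hxT, hT⟩ := hG.localTriangle x
      obtain ⟨C, hC⟩ := hT.exists_quasiMetricOn hG.diag
      have h1 : ((C * n : ℕ) : ℝ≥0∞) < ∫⁻ y in T, G x y ∂μ := by
        rw [hG.setLIntegral_eq_top (hTo.mem_nhds hxT) hx]
        exact ENNReal.natCast_lt_top _
      obtain ⟨K, hK⟩ := exists_lt_lintegral_min_natCast (hG.measurable_section x) h1
      rw [mem_interior_iff_mem_nhds]
      filter_upwards [hTo.mem_nhds hxT,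
        (hG.tendsto x).eventually (lt_mem_nhds (ENNReal.natCast_lt_top K))] with y hyT hyK
      have h2 := hK.le.trans (lintegral_min_le_of_le_kernel hC (ν := μ.restrict T)
        (by rw [Measure.restrict_apply hTo.measurableSet.compl]; simp) hxT hyT hyK.le)
      have hC0 : (C : ℝ≥0∞) ≠ 0 := by
        have := hC.one_le
        exact_mod_cast (by omega : C ≠ 0)
      rw [Nat.cast_mul, ENNReal.mul_le_mul_iff_right hC0 (ENNReal.natCast_ne_top _)] at h2
      refine h2.trans ((lintegral_mono fun z => min_le_left _ _).trans ?_)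
      exact setLIntegral_le_lintegral _ _
    · intro hx
      refine ENNReal.eq_top_of_forall_nnreal_le fun r => ?_
      obtain ⟨n, hn⟩ := exists_nat_ge r
      have h1 : (n : ℝ≥0∞) ≤ potential G μ x :=
        interior_subset (s := {x | (n : ℝ≥0∞) ≤ potential G μ x}) (hx n)
      refine le_trans ?_ h1
      exact_mod_cast hn
  rw [h]
  exact IsGδ.iInter fun n => isOpen_interior.isGδ

/-! ### Construction of the measure on the countable dense set -/

section Construction

variable {X : Type*} [TopologicalSpace X] [T2Space X] [LocallyCompactSpace X]
  [SecondCountableTopology X] [MeasurableSpace X] [BorelSpace X] {G : X → X → ℝ≥0∞}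

/-- The weight of `exists_weight`, times a small constant, makes the potential small off `U`. It
keeps the poles on `P ∩ A`, since these depend only on mass nearby, where the weight is bounded
below. -/
lemma IsPotentialKernel.exists_locallyDiscrete (hG : IsPotentialKernel G) {T : Set X} {C : ℕ}
    (hT : QuasiMetricOn G T C) (hTo : IsOpen T) {A P Q U : Set X} (hAT : closure A ⊆ T)
    (hQ : Q ⊆ P ∩ A) (hQm : MeasurableSet Q) (hU : IsOpen U) (hPU : P ⊆ U) {ν : Measure X}
    [IsFiniteMeasure ν] (hνQ : ν Qᶜ = 0) (hνP : ∀ x ∈ P ∩ A, potential G ν x = ∞)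
    {δ : ℝ≥0∞} (hδ : δ ≠ 0) :
    ∃ μ : Measure X, μ univ ≤ δ ∧ μ Qᶜ = 0 ∧ (∀ x ∈ P ∩ A, 1 ≤ potential G μ x) ∧
      (∀ x ∈ T, x ∉ U → potential G μ x ≤ δ) ∧ ∀ x ∉ P, potential G μ x < ∞ := by
  have hC := hT.one_le
  have hne : ∀ n : ℕ, (n : ℝ≥0∞) ≠ ∞ := ENNReal.natCast_ne_top
  obtain ⟨f, hfm, hf1, hfU, hfloc⟩ := hG.exists_weight hT hTo hU
  -- One factor `C ^ 3` is lost by discretizing, the other by normalizing the lower bound to `1`.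
  let M : ℝ≥0∞ := (C ^ 3 : ℕ) * ((C ^ 3 : ℕ) * (ν univ + 1))
  have hCpos : ((C ^ 3 : ℕ) : ℝ≥0∞) ≠ 0 := by
    have : C ^ 3 ≠ 0 := pow_ne_zero 3 (by omega)
    exact_mod_cast this
  have hM0 : M ≠ 0 := mul_ne_zero hCpos (mul_ne_zero hCpos (by simp))
  have hMt : M ≠ ∞ := ENNReal.mul_ne_top (hne _) (ENNReal.mul_ne_top (hne _) (by simp))
  let c : ℝ≥0∞ := min δ 2⁻¹ / M
  have hcM : c * M = min δ 2⁻¹ := ENNReal.div_mul_cancel hM0 hMt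
  have hc0 : c ≠ 0 := ENNReal.div_ne_zero.2 ⟨by simp [hδ], hMt⟩
  have hct : c ≠ ∞ := ENNReal.div_ne_top (ne_top_of_le_ne_top (by simp) (min_le_right _ _)) hM0
  have hcν : (C ^ 3 : ℕ) * ((C ^ 3 : ℕ) * (c * ν univ)) ≤ min δ 2⁻¹ := by
    rw [← hcM]
    calc (C ^ 3 : ℕ) * ((C ^ 3 : ℕ) * (c * ν univ))
        = c * ((C ^ 3 : ℕ) * ((C ^ 3 : ℕ) * ν univ)) := by ring
      _ ≤ c * ((C ^ 3 : ℕ) * ((C ^ 3 : ℕ) * (ν univ + 1))) := by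
        gcongr
        exact le_self_add
  have hC3 : 1 ≤ C ^ 3 := Nat.one_le_pow _ _ hC
  let ν' : Measure X := c • ν.withDensity f
  have hmass : ν' univ ≤ c * ν univ := by
    rw [Measure.smul_apply, withDensity_apply _ MeasurableSet.univ, Measure.restrict_univ,
      smul_eq_mul]
    gcongr
    calc ∫⁻ z, f z ∂ν ≤ ∫⁻ _, 1 ∂ν := lintegral_mono hf1
      _ = ν univ := lintegral_one
  have hfin : IsFiniteMeasure ν' :=
    ⟨hmass.trans_lt (ENNReal.mul_lt_top hct.lt_top (measure_lt_top _ _))⟩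
  have hν'Q : ν' Qᶜ = 0 := by
    rw [Measure.smul_apply, withDensity_absolutelyContinuous ν f hνQ, smul_zero]
  have hpot : ∀ x, potential G ν' x = c * ∫⁻ z, f z * G x z ∂ν := by
    intro x
    rw [potential_smul, potential,
      lintegral_withDensity_eq_lintegral_mul _ hfm (hG.measurable_section x)]
    rfl
  have hν'U : ∀ x ∈ T, x ∉ U → potential G ν' x ≤ c * ν univ := by
    intro x hxT hxU
    rw [hpot]
    gcongr
    calc ∫⁻ z, f z * G x z ∂ν ≤ ∫⁻ _, 1 ∂ν := lintegral_mono fun z => hfU x hxT hxU z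
      _ = ν univ := lintegral_one
  have hν'P : ∀ x ∈ P ∩ A, potential G ν' x = ∞ := by
    intro x hx
    obtain ⟨O, hO, hxO, d, hd0, hd⟩ := hfloc x ⟨hPU hx.1, hAT (subset_closure hx.2)⟩
    have h1 : ∫⁻ z, f z * G x z ∂ν = ∞ := by
      refine top_le_iff.1 ?_
      calc ∞ = d * ∫⁻ z in O, G x z ∂ν := by
            rw [hG.setLIntegral_eq_top (hO.mem_nhds hxO) (hνP x hx), ENNReal.mul_top hd0]
        _ = ∫⁻ z in O, d * G x z ∂ν := (lintegral_const_mul _ (hG.measurable_section x)).symm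
        _ ≤ ∫⁻ z in O, f z * G x z ∂ν :=
          setLIntegral_mono' hO.measurableSet fun z hz => by gcongr; exact hd z hz
        _ ≤ _ := setLIntegral_le_lintegral _ _
    rw [hpot, h1, ENNReal.mul_top hc0]
  have hν'1 : ∀ x ∈ T, x ∉ U → potential G ν' x < 1 := by
    intro x hxT hxU
    refine (hν'U x hxT hxU).trans_lt ?_
    have h1 : c * ν univ ≤ (C ^ 3 : ℕ) * ((C ^ 3 : ℕ) * (c * ν univ)) :=
      (ENNReal.le_natCast_mul hC3 _).trans (ENNReal.le_natCast_mul hC3 _)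
    refine (h1.trans (hcν.trans (min_le_right _ _))).trans_lt ?_
    rw [ENNReal.inv_lt_one]
    exact ENNReal.one_lt_two
  obtain ⟨μ, hμ1, hμ2, hμ3, hμ4, hμ5⟩ := hG.exists_locallyDiscrete_aux hT hTo (U := U) hAT hQ hQm
    hν'Q hν'P hν'1
  refine ⟨((C ^ 3 : ℕ) : ℝ≥0∞) • μ, ?_, ?_, ?_, ?_, ?_⟩
  · rw [Measure.smul_apply, smul_eq_mul]
    refine le_trans ?_ (hcν.trans (min_le_left _ _))
    gcongr
    exact (hμ1.trans hmass).trans (ENNReal.le_natCast_mul hC3 _)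
  · rw [Measure.smul_apply, hμ2, smul_zero]
  · intro x hx
    rw [potential_smul]
    exact hμ3 x hx
  · intro x hxT hxU
    rw [potential_smul]
    refine le_trans ?_ (hcν.trans (min_le_left _ _))
    gcongr
    exact (hμ4 x hxT hxU).trans (by gcongr; exact hν'U x hxT hxU)
  · intro x hx
    rw [potential_smul]
    exact ENNReal.mul_lt_top (hne _).lt_top (hμ5 x hx)

/-- Infinitely many potentials at least `1` add up to `∞` on `P ∩ A`. A point of `T` off `P` leaves
the decreasing sets `U n` eventually, so that all but finitely many terms there are bounded by a
geometric series. -/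
lemma IsPotentialKernel.exists_local_measure (hG : IsPotentialKernel G) {T : Set X} {C : ℕ}
    (hT : QuasiMetricOn G T C) (hTo : IsOpen T) {A P Q : Set X} (hAT : closure A ⊆ T)
    (hQ : Q ⊆ P ∩ A) (hQc : Q.Countable) (hQd : P ∩ A ⊆ closure Q) (hP : IsGδ P)
    {ν : Measure X} [IsFiniteMeasure ν] (hν : ∀ x ∈ P, potential G ν x = ∞)
    {δ : ℝ≥0∞} (hδ : δ ≠ 0) (hδt : δ ≠ ∞) :
    ∃ μ : Measure X, μ univ ≤ δ ∧ μ Qᶜ = 0 ∧ (∀ x ∈ P ∩ A, potential G μ x = ∞) ∧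
      ∀ x ∉ P, potential G μ x < ∞ := by
  rcases Q.eq_empty_or_nonempty with rfl | hQne
  · refine ⟨0, by simp, by simp, fun x hx => ?_, fun x _ => by simp [potential]⟩
    simpa using hQd hx
  have hAT' : A ⊆ T := subset_closure.trans hAT
  obtain ⟨p, rfl⟩ := hQc.exists_eq_range hQne
  have hp : ∀ j, p j ∈ T := fun j => hAT' (hQ (mem_range_self j)).2
  have hpm : MeasurableSet (range p) := hQc.measurableSet
  obtain ⟨σ, hσfin, hσ1, hσ2⟩ := hG.exists_discrete_measure_potential_eq_top hT hTo.measurableSet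
    (ν := ν.restrict T) (by rw [Measure.restrict_apply hTo.measurableSet.compl]; simp) hp hpm
  have hσP : ∀ x ∈ P ∩ A, potential G σ x = ∞ := fun x hx =>
    hσ2 x (hAT' hx.2) (hQd hx) (hG.setLIntegral_eq_top (hTo.mem_nhds (hAT' hx.2)) (hν x hx.1))
  obtain ⟨V, hVo, hPV⟩ := isGδ_iff_eq_iInter_nat.1 hP
  let U : ℕ → Set X := fun n => ⋂ k ∈ Iic n, V k
  have hUo : ∀ n, IsOpen (U n) := fun n => (finite_Iic n).isOpen_biInter fun k _ => hVo k
  have hPU : ∀ n, P ⊆ U n := fun n x hx => mem_iInter₂.2 fun k _ => by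
    rw [hPV] at hx
    exact mem_iInter.1 hx k
  have hδn : ∀ n : ℕ, δ * 2⁻¹ ^ (n + 1) ≠ 0 := fun n =>
    mul_ne_zero hδ (pow_ne_zero _ (by simp))
  choose μ hμ1 hμ2 hμ3 hμ4 hμ5 using fun n => hG.exists_locallyDiscrete hT hTo hAT hQ hpm (hUo n)
    (hPU n) hσ1 hσP (hδn n)
  have hmass : (Measure.sum μ) univ ≤ δ := by
    rw [Measure.sum_apply _ MeasurableSet.univ]
    exact (ENNReal.tsum_le_tsum hμ1).trans (tsum_mul_two_inv_pow_succ δ).le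
  have hcar : (Measure.sum μ) (range p)ᶜ = 0 := by
    rw [Measure.sum_apply _ hpm.compl]
    simp [hμ2]
  refine ⟨Measure.sum μ, hmass, hcar, fun x hx => ?_, fun x hx => ?_⟩
  · rw [potential_sum, ← top_le_iff, ← ENNReal.tsum_const_eq_top_of_ne_zero (α := ℕ) one_ne_zero]
    exact ENNReal.tsum_le_tsum fun n => hμ3 n x hx
  · by_cases hxT : x ∈ T
    · have hxV : ∃ k, x ∉ V k := by
        rw [hPV, mem_iInter] at hx
        push Not at hx
        exact hx
      obtain ⟨k, hk⟩ := hxV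
      rw [potential_sum]
      refine ENNReal.tsum_lt_top_of_le_off_finite (finite_Iio k) (fun n => hμ5 n x hx)
        (b := fun n => δ * 2⁻¹ ^ (n + 1)) (fun n hn => hμ4 n x hxT fun h => hk ?_) ?_
      · exact mem_iInter₂.1 h k (mem_Iic.2 (not_lt.1 hn))
      · rw [tsum_mul_two_inv_pow_succ]
        exact hδt.lt_top
    · have : IsFiniteMeasure (Measure.sum μ) := ⟨hmass.trans_lt hδt.lt_top⟩
      refine hG.potential_lt_top (N := (closure A)ᶜ)
        (isClosed_closure.isOpen_compl.mem_nhds fun h => hxT (hAT h))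
        (measure_mono_null (compl_subset_compl.2 fun y hy => subset_closure (hQ hy).2) hcar)

/-- Local measures are summed over a locally finite cover. At a point off `P`, the finitely many
pieces nearby have finite potentials, and the rest is a finite measure without mass near the point.
-/
lemma IsPotentialKernel.exists_discrete_measure_of_isGδ (hG : IsPotentialKernel G) {P P₀ : Set X}
    (hP₀P : P₀ ⊆ P) (hP₀ : P₀.Countable) (hdense : P ⊆ closure P₀) (hP : IsGδ P)
    (hcap : cStar G P = 0) :
    ∃ μ ∈ finiteMeasuresOn P₀, {x | potential G μ x = ∞} = P := by
  obtain ⟨ν, hνfin, hν⟩ := exists_potential_eq_top_of_cStar_eq_zero hcap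
  choose T hTo hxT hT using hG.localTriangle
  choose B hB hBc hBT using fun x => exists_mem_nhds_isClosed_subset ((hTo x).mem_nhds (hxT x))
  obtain ⟨D, hDo, hDU, hDB, hDfin⟩ := isOpen_univ.exists_locallyFinite_cover B fun w _ => hB w
  have hloc : ∀ n, ∃ μ : Measure X, μ univ ≤ 1 * 2⁻¹ ^ (n + 1) ∧ μ (P₀ ∩ D n)ᶜ = 0 ∧
      (∀ x ∈ P ∩ D n, potential G μ x = ∞) ∧ ∀ x ∉ P, potential G μ x < ∞ := by
    intro n
    by_cases hn : (D n).Nonempty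
    · obtain ⟨w, -, hw⟩ := hDB n hn
      obtain ⟨C, hC⟩ := (hT w).exists_quasiMetricOn hG.diag
      refine hG.exists_local_measure hC (hTo w) (((hBc w).closure_subset_iff.2 hw).trans (hBT w))
        (inter_subset_inter_left _ hP₀P) (hP₀.mono inter_subset_left) ?_ hP hν
        (mul_ne_zero one_ne_zero (pow_ne_zero _ (by simp)))
        (ENNReal.mul_ne_top ENNReal.one_ne_top (ENNReal.pow_ne_top (by simp)))
      rintro x ⟨hxP, hxD⟩
      rw [inter_comm]
      exact (hDo n).inter_closure ⟨hxD, hdense hxP⟩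
    · refine ⟨0, by simp, by simp, fun x hx => absurd ⟨x, hx.2⟩ hn, fun x _ => by simp [potential]⟩
  choose μ hμ1 hμ2 hμ3 hμ4 using hloc
  have hmass : ∑' n, μ n univ < ∞ :=
    ((ENNReal.tsum_le_tsum hμ1).trans (tsum_mul_two_inv_pow_succ 1).le).trans_lt
      ENNReal.one_lt_top
  refine ⟨Measure.sum μ, ⟨⟨?_⟩, ?_⟩, Subset.antisymm (fun x hx => ?_) fun x hx => ?_⟩
  · rwa [Measure.sum_apply _ MeasurableSet.univ]
  · rw [Measure.sum_apply _ hP₀.measurableSet.compl, ENNReal.tsum_eq_zero]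
    exact fun n => measure_mono_null (compl_subset_compl.2 inter_subset_left) (hμ2 n)
  · by_contra hxP
    refine (lt_top_iff_ne_top.1 ?_) hx
    obtain ⟨O, hO, hfin⟩ := hDfin x (mem_univ x)
    classical
    -- The pieces away from `x`: their sum does not charge `O`.
    let μ' : ℕ → Measure X := fun n => if (D n ∩ O).Nonempty then 0 else μ n
    have hμ' : ∀ n, μ' n ≤ μ n := fun n => by
      simp only [μ']
      split_ifs
      · exact Measure.zero_le _
      · exact le_rfl
    have hfin' : IsFiniteMeasure (Measure.sum μ') := ⟨by
      rw [Measure.sum_apply _ MeasurableSet.univ]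
      exact (ENNReal.tsum_le_tsum fun n => hμ' n univ).trans_lt hmass⟩
    obtain ⟨V, hVO, hVo, hxV⟩ := mem_nhds_iff.1 hO
    have hV : (Measure.sum μ') V = 0 := by
      rw [Measure.sum_apply _ hVo.measurableSet, ENNReal.tsum_eq_zero]
      intro n
      simp only [μ']
      split_ifs with h
      · simp
      · refine measure_mono_null (t := (P₀ ∩ D n)ᶜ) (fun y hy hyD => h ⟨y, hyD.2, hVO hy⟩) (hμ2 n)
    have hpot := hG.potential_lt_top (hVo.mem_nhds hxV) hV
    rw [potential_sum] at hpot ⊢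
    refine ENNReal.tsum_lt_top_of_le_off_finite hfin (fun n => hμ4 n x hxP) (fun n hn => ?_) hpot
    have : μ' n = μ n := if_neg hn
    rw [this]
  · have hxD : x ∈ ⋃ n, D n := hDU ▸ mem_univ x
    obtain ⟨n, hn⟩ := mem_iUnion.1 hxD
    rw [mem_ofPred_eq, potential_sum]
    exact top_le_iff.1 ((hμ3 n x ⟨hx, hn⟩).symm.le.trans (ENNReal.le_tsum n))

end Construction

/-! ### The equivalence -/

theorem theorem2 {X : Type*} [TopologicalSpace X] [T2Space X] [LocallyCompactSpace X]
    [SecondCountableTopology X] [MeasurableSpace X] [BorelSpace X]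
    (G : X → X → ℝ≥0∞) (hG : IsPotentialKernel G)
    (P P₀ : Set X) (hP₀P : P₀ ⊆ P) (hP₀ : P₀.Countable) (hdense : P ⊆ closure P₀) :
    List.TFAE
      [IsGδ P ∧ cStar G P = 0,
       ∃ μ ∈ finiteMeasuresOn P, {x | potential G μ x = ∞} = P,
       ∃ μ ∈ finiteMeasuresOn P₀, {x | potential G μ x = ∞} = P] := by
  tfae_have 1 → 3 := fun h => hG.exists_discrete_measure_of_isGδ hP₀P hP₀ hdense h.1 h.2
  tfae_have 3 → 2 := by
    rintro ⟨μ, ⟨hfin, hμ⟩, h⟩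
    exact ⟨μ, ⟨hfin, measure_mono_null (compl_subset_compl.2 hP₀P) hμ⟩, h⟩
  tfae_have 2 → 1 := by
    rintro ⟨μ, ⟨hfin, -⟩, h⟩
    refine ⟨h ▸ hG.isGδ_setOf_potential_eq_top μ, ?_⟩
    exact cStar_eq_zero_of_potential_eq_top (μ := μ) fun x hx => by rw [← h] at hx; exact hx
  tfae_finish
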